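/- All graphs are finite and simple. A graph is *triangulated* (chordal) if it has no induced cycle of length at least $4$. A *star* is a tree having a vertex adjacent to all its other vertices (so $K_1$ and $K_2$ are stars); a star in $G$ is a (not necessarily induced) subgraph of $G$ that is a star. Let $\theta_S(G)$ be the minimum number of stars in $G$ such that every vertex of $G$ lies in at least one of them, and let $\alpha_S(G)$ be the maximum size of a set $T\subseteq V(G)$ such that no two distinct vertices of $T$ lie in a common star in $G$. The graph $G$ is *$S$-perfect* if $\theta_S(H)=\alpha_S(H)$ for every induced subgraph $H$ of $G$. For $k\ge 3$, a *$k$-sun* is a graph whose vertices are $2k$ distinct vertices $v_1,\dots,v_k,u_1,\dots,u_k$ such that, with indices modulo $k$, $v_i$ is adjacent to $v_{i+1}$ for every $i$ (so $v_1v_2\cdots v_kv_1$ is a Hamiltonian cycle of the subgraph induced by $v_1,\dots,v_k$, which may have further edges), and the neighbours of $u_i$ are exactly $v_i$ and $v_{i+1}$ for every $i$. An *odd sun* is a $k$-sun with $k$ odd. **Theorem.** A triangulated graph $G$ is $S$-perfect if and only if no induced subgraph of $G$ is an odd sun. -/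

import Mathlib

namespace SPerfect

variable {V : Type*}

/-- A graph is triangulated (chordal) if it has no induced cycle of length at least `4`. -/
def IsTriangulated (G : SimpleGraph V) : Prop :=
  ∀ n : ℕ, 4 ≤ n → IsEmpty (SimpleGraph.cycleGraph n ↪g G)

/-- A subgraph `S` of `G` is a star: it is a tree with a vertex `c` that is adjacent in `S`
to all other vertices of `S` (so single vertices and single edges are stars). -/
def IsStar {G : SimpleGraph V} (S : G.Subgraph) : Prop :=
  S.coe.IsTree ∧ ∃ c ∈ S.verts, ∀ w ∈ S.verts, w ≠ c → S.Adj c w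

/-- A finite family of stars of `G` such that every vertex of `G` lies in one of them. -/
def IsStarCover (G : SimpleGraph V) (F : Finset G.Subgraph) : Prop :=
  (∀ S ∈ F, IsStar S) ∧ ∀ v : V, ∃ S ∈ F, v ∈ S.verts

/-- No two distinct vertices of `T` lie in a common star of `G`. -/
def IsSIndependent (G : SimpleGraph V) (T : Finset V) : Prop :=
  ∀ x ∈ T, ∀ y ∈ T, x ≠ y → ¬ ∃ S : G.Subgraph, IsStar S ∧ x ∈ S.verts ∧ y ∈ S.verts

/-- The star-covering number of a finite graph. The set is nonempty for finite `V`, as the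
single vertices form a star cover. -/
noncomputable def starCoverNumber (G : SimpleGraph V) : ℕ :=
  sInf {n : ℕ | ∃ F : Finset G.Subgraph, IsStarCover G F ∧ F.card = n}

/-- The `S`-independence number of a finite graph. The set contains `0` and is bounded by the
number of vertices. -/
noncomputable def sIndependenceNumber (G : SimpleGraph V) : ℕ :=
  sSup {n : ℕ | ∃ T : Finset V, IsSIndependent G T ∧ T.card = n}

/-- The two parameters agree on every induced subgraph. -/
def IsSPerfect (G : SimpleGraph V) : Prop :=
  ∀ D : Set V, starCoverNumber (G.induce D) = sIndependenceNumber (G.induce D)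

/-- `G` is a `k`-sun: its vertices are the `2 * k` distinct vertices `v i`, `u i` with indices
modulo `k`; the `v i` form, in this cyclic order, a Hamiltonian cycle of the subgraph that they
induce, which may have any further edges; and the neighbours of `u i` are exactly `v i` and
`v (i + 1)`. As these two are adjacent, every `u i` is simplicial. -/
def IsSun (k : ℕ) (G : SimpleGraph V) : Prop :=
  3 ≤ k ∧ ∃ v u : ZMod k → V,
    Function.Injective v ∧ Function.Injective u ∧ (∀ i j, v i ≠ u j) ∧
    (∀ w : V, (∃ i, w = v i) ∨ ∃ i, w = u i) ∧
    (∀ i, G.Adj (v i) (v (i + 1))) ∧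
    ∀ i w, G.Adj (u i) w ↔ w = v i ∨ w = v (i + 1)

/-- No induced subgraph of `G` is a `k`-sun with `k` odd. -/
def IsOddSunFree (G : SimpleGraph V) : Prop :=
  ∀ D : Set V, ¬ ∃ k : ℕ, Odd k ∧ IsSun k (G.induce D)

end SPerfect

/-! Every star lies in a closed neighbourhood, and every closed neighbourhood is spanned by a star.
So both parameters belong to the hypergraph of closed neighbourhoods: the least number of edges
covering all vertices, and the largest set of vertices meeting each edge at most once. The second
never exceeds the first.

In an odd `k`-sun the two are separated by parity: covering the `u i` takes at least `k / 2`
neighbourhoods, while each independent vertex uses up two of the `v i` (`IsSun.starCoverNumber_ne`).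

Conversely, suppose the hypergraph has an odd special cycle. Chordality makes one side of it
consecutively near and then the other side stable, which is an odd sun. Hence odd-sun-free
triangulated graphs have balanced neighbourhood hypergraphs (`IsOddSunFree.isBalanced`), a property
inherited by induced subgraphs. Balanced hypergraphs have the König property
(`IsBalanced.exists_stable_cover`), obtained from bicolourings by way of strong colourings. -/

namespace SPerfect

open SimpleGraph

/-! ### Closed walks in triangulated graphs -/

section Near

variable {V : Type*} {G : SimpleGraph V}

/-- `v` lies in the closed neighbourhood of `u`. -/
def Near (G : SimpleGraph V) (u v : V) : Prop := u = v ∨ G.Adj u v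

lemma Near.refl (u : V) : Near G u u := Or.inl rfl

lemma Near.symm {u v : V} (h : Near G u v) : Near G v u :=
  h.imp Eq.symm SimpleGraph.Adj.symm

lemma Near.comm {u v : V} : Near G u v ↔ Near G v u := ⟨Near.symm, Near.symm⟩

lemma cycleGraph_adj_of_lt {N : ℕ} {u v : Fin N} (h : u < v) :
    (cycleGraph N).Adj u v ↔ (v : ℕ) = u + 1 ∨ ((u : ℕ) = 0 ∧ (v : ℕ) + 1 = N) := by
  rw [cycleGraph_adj', Fin.coe_sub_iff_lt.mpr h, Fin.sub_val_of_le h.le]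
  have : (u : ℕ) < v := h
  have := v.isLt
  lia

lemma nonempty_cycleGraph_embedding {N : ℕ} (c : ℕ → V)
    (hne : ∀ i j, i < j → j < N → c i ≠ c j)
    (hadj : ∀ i j, i < j → j < N → (G.Adj (c i) (c j) ↔ j = i + 1 ∨ (i = 0 ∧ j + 1 = N))) :
    Nonempty (cycleGraph N ↪g G) := by
  refine ⟨⟨⟨fun i => c i, fun i j hij => ?_⟩, fun {i j} => ?_⟩⟩
  · rcases lt_trichotomy i j with h | h | h
    · exact (hne i j h j.2 hij).elim
    · exact h
    · exact (hne j i h i.2 hij.symm).elim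
  · change G.Adj (c i) (c j) ↔ _
    rcases lt_trichotomy i j with h | h | h
    · rw [cycleGraph_adj_of_lt h, hadj i j h j.2]
    · simp [h]
    · rw [SimpleGraph.adj_comm, hadj j i h i.2, SimpleGraph.adj_comm, cycleGraph_adj_of_lt h]

/-- In a triangulated graph, any edge of a closed walk (with repetitions and stationary steps
allowed) spans a triangle with another vertex of the walk. -/
lemma IsTriangulated.exists_common_near (hG : IsTriangulated G) {a b : V} (hab : Near G a b)
    (n : ℕ) (s : ℕ → V) (hs : ∀ m < n, Near G (s m) (s (m + 1)))
    (ha : Near G a (s 0)) (hb : Near G (s n) b) :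
    ∃ m ≤ n, Near G a (s m) ∧ Near G (s m) b := by
  induction n using Nat.strong_induction_on generalizing s with
  | _ n ih =>
  by_contra! hcon
  -- In a minimal counterexample a prefix, a suffix or a chord would give a shorter walk; so `a`,
  -- the walk and `b` form an induced cycle.
  have hnb : ∀ j < n, ¬ Near G (s j) b := fun j hj h => by
    obtain ⟨m, hm, h1, h2⟩ := ih j hj s (fun m hm => hs m (hm.trans hj)) ha h
    exact hcon m (hm.trans hj.le) h1 h2
  have hna : ∀ j, 0 < j → j ≤ n → ¬ Near G a (s j) := fun j h0 hj h => by
    obtain ⟨m, hm, h1, h2⟩ := ih (n - j) (by lia) (fun m => s (m + j))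
      (fun m hm => by simpa [add_right_comm] using hs (m + j) (by lia)) (by simpa using h)
      (by simpa [Nat.sub_add_cancel hj] using hb)
    exact hcon _ (by lia) h1 h2
  have hchord : ∀ i j, i + 1 < j → j ≤ n → ¬ Near G (s i) (s j) := fun i j hij hj h => by
    obtain ⟨m, hm, h1, h2⟩ := ih (n - (j - i - 1)) (by lia)
      (fun m => if m ≤ i then s m else s (m + (j - i - 1)))
      (fun m hm => by
        rcases lt_trichotomy m i with h' | h' | h'
        · simpa [h'.le, Nat.succ_le_of_lt h'] using hs m (by lia)
        · subst h'
          have : m + 1 + (j - m - 1) = j := by lia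
          simpa [this] using h
        · have e : m + 1 + (j - i - 1) = m + (j - i - 1) + 1 := by lia
          simpa [not_le.mpr h', show ¬ m + 1 ≤ i by lia, e] using hs (m + (j - i - 1)) (by lia))
      (by simpa using ha)
      (by
        have e : n - (j - i - 1) + (j - i - 1) = n := by lia
        simpa [show ¬ n - (j - i - 1) ≤ i by lia, e] using hb)
    split_ifs at h1 h2
    · exact hcon _ (by lia) h1 h2
    · exact hcon _ (by lia) h1 h2
  have hn : 0 < n := Nat.pos_of_ne_zero fun h => by
    subst h
    exact hcon 0 le_rfl ha hb
  have hab' : a ≠ b := fun h => by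
    subst h
    exact hcon 0 n.zero_le ha ha.symm
  -- A stationary step would turn the next step into a chord, or the last vertex into an earlier
  -- neighbour of `b`.
  have hstep : ∀ i < n, G.Adj (s i) (s (i + 1)) := fun i hi => by
    refine (hs i hi).resolve_left fun h => ?_
    rcases Nat.lt_or_ge (i + 1) n with h' | h'
    · exact hchord i (i + 2) (by lia) h' (h ▸ hs (i + 1) h')
    · obtain rfl : n = i + 1 := by lia
      exact hnb i (by lia) (h ▸ hb)
  -- The induced cycle `a, s 0, …, s n, b` has length `n + 3`, at least `4` because `0 < n`.
  let c : ℕ → V := fun m => if m = 0 then a else if m = n + 2 then b else s (m - 1)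
  have c0 : c 0 = a := by simp [c]
  have cl : c (n + 2) = b := by simp [c]
  have cs : ∀ m ≤ n, c (m + 1) = s m := fun m hm => by
    simp [c]
    lia
  have key : ∀ i j, i < j → j < n + 3 →
      (Near G (c i) (c j) → j = i + 1 ∨ (i = 0 ∧ j + 1 = n + 3)) ∧
      (j = i + 1 ∨ (i = 0 ∧ j + 1 = n + 3) → G.Adj (c i) (c j)) := by
    intro i j hij hj
    rcases Nat.eq_zero_or_pos i with rfl | hi
    · rcases Nat.lt_or_ge j (n + 2) with hj' | hj'
      · obtain ⟨j, rfl⟩ : ∃ m, j = m + 1 := ⟨j - 1, by lia⟩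
        rw [c0, cs j (by lia)]
        rcases Nat.eq_zero_or_pos j with rfl | hj0
        · refine ⟨by simp, fun _ => ha.resolve_left fun h => ?_⟩
          exact hcon 0 n.zero_le ha (h ▸ hab)
        · exact ⟨fun h => (hna j hj0 (by lia) h).elim, fun h => by lia⟩
      · obtain rfl : j = n + 2 := by lia
        rw [c0, cl]
        exact ⟨by simp, fun _ => hab.resolve_left hab'⟩
    · obtain ⟨i, rfl⟩ : ∃ m, i = m + 1 := ⟨i - 1, by lia⟩
      rw [cs i (by lia)]
      rcases Nat.lt_or_ge j (n + 2) with hj' | hj'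
      · obtain ⟨j, rfl⟩ : ∃ m, j = m + 1 := ⟨j - 1, by lia⟩
        rw [cs j (by lia)]
        constructor
        · intro h
          by_contra h'
          exact hchord i j (by lia) (by lia) h
        · intro h
          obtain rfl : j = i + 1 := by lia
          exact hstep i (by lia)
      · obtain rfl : j = n + 2 := by lia
        rw [cl]
        constructor
        · intro h
          by_contra h'
          exact hnb i (by lia) h
        · intro h
          obtain rfl : i = n := by lia
          refine hb.resolve_left fun h => ?_
          exact hcon i le_rfl (h ▸ hab) hb
  refine (hG (n + 3) (by lia)).false (nonempty_cycleGraph_embedding c ?_ ?_).some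
  · intro i j hij hj h
    have := (key i j hij hj).2 ((key i j hij hj).1 (Or.inl h))
    exact this.ne h
  · exact fun i j hij hj => ⟨fun h => (key i j hij hj).1 (Or.inr h), (key i j hij hj).2⟩


end Near

/-! ### From special cycles of closed neighbourhoods to suns -/

section SpecialCycle

variable {α β V : Type*} {G : SimpleGraph V} {k : ℕ}

/-- `x` and `y` form a special cycle of length `k` of the hypergraph with vertices `α`, edges `β`
and incidence relation `r`: the edge `y i` contains, among the `x j`, exactly `x i` and
`x (i + 1)`. -/
def IsSpecialCycle (r : β → α → Prop) (k : ℕ) (x : ZMod k → α) (y : ZMod k → β) : Prop :=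
  ∀ i j, r (y i) (x j) ↔ j = i ∨ j = i + 1

/-- The hypergraph with incidence relation `r` has no special cycle of odd length at least `3`. -/
def IsBalanced (r : β → α → Prop) : Prop :=
  ∀ k, Odd k → 3 ≤ k → ∀ x y, ¬ IsSpecialCycle r k x y

lemma zmod_natCast_ne_zero {t : ℕ} (h0 : 0 < t) (ht : t < k) : (t : ZMod k) ≠ 0 := fun h =>
  (Nat.le_of_dvd h0 ((ZMod.natCast_eq_zero_iff t k).mp h)).not_gt ht

lemma zmod_one_ne_zero (hk : 3 ≤ k) : (1 : ZMod k) ≠ 0 := by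
  simpa using zmod_natCast_ne_zero (k := k) (t := 1) (by lia) (by lia)

lemma zmod_two_ne_zero (hk : 3 ≤ k) : (2 : ZMod k) ≠ 0 := by
  simpa using zmod_natCast_ne_zero (k := k) (t := 2) (by lia) (by lia)

lemma zmod_natCast_sub_one (hk : 3 ≤ k) : ((k - 1 : ℕ) : ZMod k) = -1 := by
  rw [Nat.cast_sub (by lia)]
  simp

variable {x y : ZMod k → V}

/-- The two sides of a special cycle of a neighbourhood hypergraph can be exchanged. -/
lemma IsSpecialCycle.swap (h : IsSpecialCycle (Near G) k x y) :
    IsSpecialCycle (Near G) k y (fun i => x (i + 1)) := fun i j => by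
  rw [Near.comm, h j (i + 1)]
  grind

lemma IsSpecialCycle.injective_right (h : IsSpecialCycle (Near G) k x y) (hk : 3 ≤ k) :
    Function.Injective y := fun i j hij => by
  have h1 := (h i i).mpr (Or.inl rfl)
  have h2 := (h i (i + 1)).mpr (Or.inr rfl)
  rw [hij, h] at h1 h2
  have := zmod_two_ne_zero hk
  grind

/-- The part `x (i + 1), y (i + 1), x (i + 2), y (i + 2), …` of a special cycle. -/
def interleave (x y : ZMod k → V) (i : ZMod k) (m : ℕ) : V :=
  if m % 2 = 0 then x (i + 1 + (m / 2 : ℕ)) else y (i + 1 + (m / 2 : ℕ))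

lemma interleave_near (h : IsSpecialCycle (Near G) k x y) (i : ZMod k) (m : ℕ) :
    Near G (interleave x y i m) (interleave x y i (m + 1)) := by
  unfold interleave
  rcases Nat.mod_two_eq_zero_or_one m with hm | hm
  · have e : (m + 1) / 2 = m / 2 := by lia
    simp only [hm, show (m + 1) % 2 = 1 by lia, e]
    exact ((h _ _).mpr (Or.inl rfl)).symm
  · have e : (m + 1) / 2 = m / 2 + 1 := by lia
    simp only [hm, show (m + 1) % 2 = 0 by lia, e]
    refine (h _ _).mpr (Or.inr ?_)
    push_cast
    ring

/-- The part of a special cycle outside `y i` and `x i` contains only two possible common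
neighbours of these. -/
lemma IsSpecialCycle.near_of_interleave (h : IsSpecialCycle (Near G) k x y) (hk : 3 ≤ k)
    (i : ZMod k) (m : ℕ) (hm : m ≤ 2 * k - 3) (h1 : Near G (y i) (interleave x y i m))
    (h2 : Near G (interleave x y i m) (x i)) :
    Near G (x i) (x (i + 1)) ∨ (m = 2 * k - 3 ∧ Near G (y (i - 1)) (y i)) := by
  -- The walk stops before index `i` recurs, so neither the position of `x i` nor that of `y i` is
  -- on it.
  have hz : ∀ t < k - 1, ((t : ℕ) : ZMod k) + 1 ≠ 0 := fun t ht => by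
    simpa using zmod_natCast_ne_zero (k := k) (t := t + 1) (by lia) (by lia)
  have hm2 : m / 2 < k - 1 := by lia
  unfold interleave at h1 h2
  split_ifs at h1 h2 with hm'
  · rw [h] at h1
    rcases h1 with e | e
    · exact absurd (by linear_combination e) (hz _ hm2)
    · rw [e] at h2
      exact Or.inl h2.symm
  · rw [h] at h2
    rcases h2 with e | e
    · exact absurd (by linear_combination -e) (hz _ hm2)
    · right
      have e' : i + 1 + ((m / 2 : ℕ) : ZMod k) = i - 1 := by linear_combination -e
      rw [e'] at h1
      refine ⟨?_, h1.symm⟩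
      by_contra hne
      refine zmod_natCast_ne_zero (k := k) (t := m / 2 + 2) (by lia) (by lia) ?_
      push_cast
      linear_combination -e

/-- The walk from `x (i + 1)` to `y (i - 1)`, of `2 * k - 3` steps, is closed up by the edge between
`y i` and `x i`. -/
lemma IsSpecialCycle.near_or_near (hG : IsTriangulated G)
    (h : IsSpecialCycle (Near G) k x y) (hk : 3 ≤ k) (i : ZMod k) :
    Near G (x i) (x (i + 1)) ∨ Near G (y (i - 1)) (y i) := by
  obtain ⟨m, hm, h1, h2⟩ := hG.exists_common_near (a := y i) (b := x i)
    ((h i i).mpr (Or.inl rfl)) (2 * k - 3) (interleave x y i)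
    (fun m _ => interleave_near h i m)
    (by
      simp only [interleave]
      exact (h _ _).mpr (Or.inr (by simp)))
    (by
      have e : (2 * k - 3) / 2 = k - 2 := by lia
      simp only [interleave, show (2 * k - 3) % 2 = 1 by lia, e]
      refine (h _ _).mpr (Or.inr ?_)
      have := zmod_natCast_sub_one hk
      rw [show k - 1 = k - 2 + 1 by lia] at this
      push_cast at this
      linear_combination -this)
  exact (h.near_of_interleave hk i m hm h1 h2).imp_right And.right

/-- Now the walk can stop one step earlier, at `x (i - 1)`, which rules out the alternative
involving `y (i - 1)`. Nearness thus propagates around the whole cycle. -/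
lemma IsSpecialCycle.near_succ (hG : IsTriangulated G)
    (h : IsSpecialCycle (Near G) k x y) (hk : 3 ≤ k) (i : ZMod k)
    (hi : Near G (x (i - 1)) (x i)) : Near G (x i) (x (i + 1)) := by
  obtain ⟨m, hm, h1, h2⟩ := hG.exists_common_near (a := y i) (b := x i)
    ((h i i).mpr (Or.inl rfl)) (2 * k - 4) (interleave x y i)
    (fun m _ => interleave_near h i m)
    (by
      simp only [interleave]
      exact (h _ _).mpr (Or.inr (by simp)))
    (by
      have e : (2 * k - 4) / 2 = k - 2 := by lia
      simp only [interleave, show (2 * k - 4) % 2 = 0 by lia, e]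
      have := zmod_natCast_sub_one hk
      rw [show k - 1 = k - 2 + 1 by lia] at this
      push_cast at this
      rw [show i + 1 + ((k - 2 : ℕ) : ZMod k) = i - 1 by linear_combination this]
      simpa using hi)
  exact (h.near_of_interleave hk i m (by lia) h1 h2).resolve_right (by lia)

/-- If the edges of a special cycle are consecutively near, its vertices are pairwise not near. -/
lemma IsSpecialCycle.not_near (hG : IsTriangulated G)
    (h : IsSpecialCycle (Near G) k x y) (hk : 3 ≤ k) (hy : ∀ i, Near G (y i) (y (i + 1)))
    {i j : ZMod k} (hij : i ≠ j) : ¬ Near G (x i) (x j) := by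
  have : NeZero k := ⟨by lia⟩
  wlog hj : j ≠ i + 1 generalizing i j
  · have h2 := zmod_two_ne_zero hk
    exact fun hn => this hij.symm (by grind) hn.symm
  intro hn
  obtain ⟨d, hdk, hd⟩ : ∃ d < k, i + (d : ZMod k) = j :=
    ⟨(j - i).val, ZMod.val_lt _, by simp⟩
  have hd0 : d ≠ 0 := by
    rintro rfl
    simp at hd
    exact hij hd
  have hd1 : d ≠ 1 := by
    rintro rfl
    simp at hd
    exact hj hd.symm
  -- The walk `y i, …, y (j - 1)` avoids `y (i - 1)`, so only `y i` can be near `x i`; but it is not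
  -- near `x j`.
  obtain ⟨m, hm, h1, h2⟩ := hG.exists_common_near hn (d - 1) (fun m => y (i + (m : ZMod k)))
    (fun m _ => by simpa [add_assoc] using hy (i + m))
    (by simpa using ((h i i).mpr (Or.inl rfl)).symm)
    (by
      refine (h _ _).mpr (Or.inr ?_)
      rw [← hd, Nat.cast_sub (by lia)]
      push_cast
      ring)
  rw [Near.comm, h] at h1
  rw [h, ← hd] at h2
  have hm0 : m = 0 := by
    by_contra hm0
    rcases h1 with e | e
    · exact zmod_natCast_ne_zero (k := k) (t := m) (by lia) (by lia) (by linear_combination -e)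
    · refine zmod_natCast_ne_zero (k := k) (t := m + 1) (by lia) (by lia) ?_
      push_cast
      linear_combination -e
  subst hm0
  rcases h2 with e | e
  · refine zmod_natCast_ne_zero (k := k) (t := d) (by lia) (by lia) ?_
    push_cast at e
    linear_combination e
  · refine zmod_natCast_ne_zero (k := k) (t := d - 1) (by lia) (by lia) ?_
    rw [Nat.cast_sub (by lia)]
    push_cast at e ⊢
    linear_combination e

/-- The `y i` form the Hamiltonian cycle. The shift to `x (i + 1)` is needed because this is the
vertex near exactly `y i` and `y (i + 1)`. -/
lemma IsSpecialCycle.exists_isSun (hG : IsTriangulated G)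
    (h : IsSpecialCycle (Near G) k x y) (hk : 3 ≤ k) (hy : ∀ i, Near G (y i) (y (i + 1))) :
    ∃ D : Set V, IsSun k (G.induce D) := by
  have hx : ∀ {i j}, Near G (x i) (x j) → i = j := fun hn => by
    by_contra hij
    exact h.not_near hG hk hy hij hn
  have h1 := zmod_one_ne_zero hk
  have hvu : ∀ i j, y i ≠ x j := fun i j e => by
    have a := hx (e ▸ (h i i).mpr (Or.inl rfl))
    have b := hx (e ▸ (h i (i + 1)).mpr (Or.inr rfl))
    exact h1 (by linear_combination a - b)
  refine ⟨Set.range y ∪ Set.range x, hk, fun i => ⟨y i, Or.inl ⟨i, rfl⟩⟩,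
    fun i => ⟨x (i + 1), Or.inr ⟨i + 1, rfl⟩⟩, fun i j hij => ?_, fun i j hij => ?_,
    fun i j hij => ?_, ?_, fun i => ?_, ?_⟩
  · exact h.injective_right hk (congrArg Subtype.val hij)
  · exact add_right_cancel (hx (Or.inl (congrArg Subtype.val hij)))
  · exact hvu _ _ (congrArg Subtype.val hij)
  · rintro ⟨w, ⟨i, rfl⟩ | ⟨i, rfl⟩⟩
    · exact Or.inl ⟨i, rfl⟩
    · exact Or.inr ⟨i - 1, by simp⟩
  · refine (hy i).resolve_left fun e => h1 ?_
    have := h.injective_right hk e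
    linear_combination -this
  · rintro i ⟨w, ⟨j, rfl⟩ | ⟨j, rfl⟩⟩
    · have e : G.Adj (x (i + 1)) (y j) ↔ Near G (y j) (x (i + 1)) :=
        ⟨fun e => Or.inr e.symm, fun e => (e.resolve_left (hvu _ _)).symm⟩
      simp only [SimpleGraph.comap_adj, Function.Embedding.subtype_apply, Subtype.ext_iff,
        (h.injective_right hk).eq_iff]
      rw [e, h]
      grind
    · simp only [SimpleGraph.comap_adj, Function.Embedding.subtype_apply, Subtype.ext_iff,
        (hvu _ _).symm, or_self, iff_false]
      intro e
      exact e.ne (congrArg x (hx (Or.inr e)))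

/-- The closed neighbourhoods of a triangulated graph without odd suns form a balanced
hypergraph. -/
theorem IsOddSunFree.isBalanced (hG : IsTriangulated G) (hS : IsOddSunFree G) :
    IsBalanced (Near G) := by
  intro k hodd hk x y h
  have : NeZero k := ⟨by lia⟩
  suffices ∃ D : Set V, IsSun k (G.induce D) by
    obtain ⟨D, hD⟩ := this
    exact hS D ⟨k, hodd, hD⟩
  -- One near pair makes all consecutive `x i` near; with no such pair, all consecutive `y i` are
  -- near.
  by_cases hx : ∃ i, Near G (x i) (x (i + 1))
  · obtain ⟨i, hi⟩ := hx
    have hn : ∀ n : ℕ, Near G (x (i + n)) (x (i + n + 1)) := fun n => by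
      induction n with
      | zero => simpa using hi
      | succ n ih =>
        have := h.near_succ hG hk (i + n + 1) (by simpa using ih)
        simpa [add_assoc] using this
    refine h.swap.exists_isSun hG hk fun j => ?_
    simpa using hn (j + 1 - i).val
  · push Not at hx
    refine h.exists_isSun hG hk fun i => ?_
    simpa using (h.near_or_near hG hk (i + 1)).resolve_left (hx _)

end SpecialCycle

/-! ### Colourings and the König property of balanced hypergraphs -/

section Balanced

variable {α β : Type*} {r : β → α → Prop}

/-- In a shortest odd closed walk, a repeated vertex would split it into two shorter closed walks,
one of them odd. -/
lemma exists_odd_cycle_of_not_colorable {Γ : SimpleGraph α} (hΓ : ¬ Γ.Colorable 2) :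
    ∃ k, Odd k ∧ 3 ≤ k ∧ ∃ y : ZMod k → α, Function.Injective y ∧ ∀ i, Γ.Adj (y i) (y (i + 1)) := by
  classical
  have hex : ∃ n, ∃ u, ∃ w : Γ.Walk u u, Odd w.length ∧ w.length = n := by
    rw [two_colorable_iff_forall_loop_even] at hΓ
    push Not at hΓ
    obtain ⟨u, w, hw⟩ := hΓ
    exact ⟨_, u, w, Nat.not_even_iff_odd.mp hw, rfl⟩
  obtain ⟨u, w, hodd, hlen⟩ := Nat.find_spec hex
  have hmin : ∀ {v} (p : Γ.Walk v v), Odd p.length → w.length ≤ p.length := fun p hp =>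
    hlen ▸ Nat.find_min' hex ⟨_, p, hp, rfl⟩
  have hinj : ∀ i j, i < j → j < w.length → w.getVert i ≠ w.getVert j := by
    intro i j hij hj e
    let p : Γ.Walk u u := (w.take i).append ((w.drop j).copy e.symm rfl)
    have e' : (w.take j).getVert i = w.getVert i := by
      rw [Walk.take_getVert, min_eq_right hij.le]
    let q : Γ.Walk (w.getVert j) (w.getVert j) := ((w.take j).drop i).copy (e'.trans e) rfl
    have hp : p.length = i + (w.length - j) := by
      simp [p, Walk.take_length, Walk.drop_length]
      lia
    have hq : q.length = j - i := by
      simp [q, Walk.take_length, Walk.drop_length]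
      lia
    rcases Nat.even_or_odd p.length with h | h
    · have hq' : Odd q.length := by
        rw [Nat.odd_iff] at hodd ⊢
        rw [Nat.even_iff] at h
        lia
      have := hmin q hq'
      lia
    · have := hmin p h
      lia
  have hne : w.length ≠ 1 := fun h => by
    have := w.adj_getVert_succ (i := 0) (by lia)
    rw [zero_add, ← h, Walk.getVert_length, Walk.getVert_zero] at this
    exact this.ne rfl
  have h3 : 3 ≤ w.length := by
    obtain ⟨m, hm⟩ := hodd
    lia
  have : NeZero w.length := ⟨by lia⟩
  refine ⟨w.length, hodd, h3, fun i => w.getVert i.val, fun i j e => ?_, fun i => ?_⟩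
  · rcases lt_trichotomy i.val j.val with h | h | h
    · exact (hinj _ _ h (ZMod.val_lt j) e).elim
    · exact ZMod.val_injective _ h
    · exact (hinj _ _ h (ZMod.val_lt i) e.symm).elim
  · have hi := ZMod.val_lt i
    have hadj := w.adj_getVert_succ hi
    have : Fact (1 < w.length) := ⟨by lia⟩
    have hv : (i + 1).val = (i.val + 1) % w.length := by
      rw [ZMod.val_add, ZMod.val_one]
    dsimp only
    rw [hv]
    rcases Nat.lt_or_ge (i.val + 1) w.length with h | h
    · rwa [Nat.mod_eq_of_lt h]
    · have e : i.val + 1 = w.length := by lia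
      rw [e, Walk.getVert_length] at hadj
      rwa [e, Nat.mod_self, Walk.getVert_zero]

/-- The graph on `S` whose edges are the traces of size two on `S` of the hypergraph edges. -/
def pairGraph (r : β → α → Prop) (S : Finset α) : SimpleGraph S where
  Adj p q := p ≠ q ∧ ∃ b, r b p ∧ r b q ∧ ∀ z : S, r b z → z = p ∨ z = q
  symm := ⟨fun _ _ ⟨h, b, hp, hq, hz⟩ => ⟨h.symm, b, hq, hp, fun z h => (hz z h).symm⟩⟩
  loopless := ⟨fun _ h => h.1 rfl⟩

lemma IsBalanced.pairGraph_colorable (h : IsBalanced r) (S : Finset α) :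
    (pairGraph r S).Colorable 2 := by
  by_contra hcol
  obtain ⟨k, hodd, hk, y, hinj, hadj⟩ := exists_odd_cycle_of_not_colorable hcol
  choose b h1 h2 h3 using fun i => (hadj i).2
  refine h k hodd hk (fun i => y i) b fun i j => ⟨fun hr => ?_, ?_⟩
  · exact (h3 i (y j) hr).imp (fun e => hinj e) (fun e => hinj e)
  · rintro (rfl | rfl)
    · exact h1 _
    · exact h2 _

/-- Every balanced hypergraph has a bicolouring: each edge with at least two vertices in `S`
receives both colours on `S`. -/
lemma IsBalanced.exists_bicoloring [Finite α] (h : IsBalanced r) (S : Finset α) :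
    ∃ g : α → Bool, ∀ b, ∀ p ∈ S, ∀ q ∈ S, p ≠ q → r b p → r b q →
      ∃ p' ∈ S, ∃ q' ∈ S, r b p' ∧ r b q' ∧ g p' ≠ g q' := by
  classical
  induction S using Finset.strongInduction with
  | H S ih =>
  rcases S.eq_empty_or_nonempty with rfl | ⟨s, hs⟩
  · exact ⟨fun _ => true, by simp⟩
  obtain ⟨col⟩ := h.pairGraph_colorable S
  let c := (pairGraph r S).connectedComponentMk ⟨s, hs⟩
  -- `x` is not a cut vertex of its component, so the neighbours of `x` stay connected to each other
  -- once it is removed.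
  obtain ⟨⟨⟨x, hxS⟩, hxc⟩, hpre⟩ :=
    c.connected_toSimpleGraph.exists_preconnected_induce_compl_singleton_of_finite
  obtain ⟨g, hg⟩ := ih (S.erase x) (Finset.erase_ssubset hxS)
  have hflip : ∀ p q : S, p.1 ≠ x → q.1 ≠ x → (pairGraph r S).Adj p q → g p ≠ g q := by
    rintro p q hp hq ⟨hpq, b, hbp, hbq, hb⟩
    obtain ⟨p', hp', q', hq', hbp', hbq', hne⟩ := hg b p (Finset.mem_erase.mpr ⟨hp, p.2⟩) q
      (Finset.mem_erase.mpr ⟨hq, q.2⟩) (fun e => hpq (Subtype.ext e)) hbp hbq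
    rcases hb ⟨p', Finset.mem_of_mem_erase hp'⟩ hbp' with e | e <;>
    rcases hb ⟨q', Finset.mem_of_mem_erase hq'⟩ hbq' with e' | e' <;>
    · have e := congrArg Subtype.val e
      have e' := congrArg Subtype.val e'
      dsimp only at e e'
      subst e e'
      first
        | exact (hne rfl).elim
        | exact hne
        | exact hne.symm
  -- `φ` compares `g` with the proper colouring `col`. Both alternate along edges avoiding `x`, so
  -- `φ` is constant on the component without `x`.
  let φ : S → Bool := fun p => xor (g p) (decide (col p = 0))
  have hφ : ∀ p q : S, p.1 ≠ x → q.1 ≠ x → (pairGraph r S).Adj p q → φ p = φ q := by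
    intro p q hp hq hadj
    have h1 := hflip p q hp hq hadj
    have h2 : col p ≠ col q := col.valid hadj
    have h3 : decide (col p = 0) ≠ decide (col q = 0) := by
      intro e
      rw [decide_eq_decide] at e
      generalize col p = i at *
      generalize col q = j at *
      fin_cases i <;> fin_cases j <;> simp_all
    simp only [φ]
    generalize g p = i at *
    generalize g q = j at *
    generalize decide (col p = 0) = i' at *
    generalize decide (col q = 0) = j' at *
    revert h1 h3
    revert i j i' j'
    decide
  have hconst : ∀ p q : S, (pairGraph r S).Adj ⟨x, hxS⟩ p → (pairGraph r S).Adj ⟨x, hxS⟩ q →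
      φ p = φ q := by
    have hmem : ∀ p, (pairGraph r S).Adj ⟨x, hxS⟩ p → p ∈ c.supp := fun p hp =>
      c.mem_supp_of_adj_mem_supp hxc hp
    have hne : ∀ (p : S) (hp : p ∈ c.supp), (pairGraph r S).Adj ⟨x, hxS⟩ p →
        (⟨p, hp⟩ : c.supp) ∈ ({⟨⟨x, hxS⟩, hxc⟩}ᶜ : Set c.supp) := fun p hp hadj e => by
      exact hadj.ne (congrArg Subtype.val e).symm
    intro p q hp hq
    obtain ⟨w⟩ := hpre ⟨⟨p, hmem p hp⟩, hne _ _ hp⟩ ⟨⟨q, hmem q hq⟩, hne _ _ hq⟩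
    have key : ∀ {a b} (_ : (c.toSimpleGraph.induce {⟨⟨x, hxS⟩, hxc⟩}ᶜ).Walk a b),
        φ a.1.1 = φ b.1.1 := by
      intro a b w
      induction w with
      | nil => rfl
      | @cons a b _ hab _ ih =>
        refine (hφ _ _ ?_ ?_ hab).trans ih
        · exact fun e => a.2 (Subtype.ext (Subtype.ext e))
        · exact fun e => b.2 (Subtype.ext (Subtype.ext e))
    exact key w
  obtain ⟨κ, hκ⟩ : ∃ κ, ∀ p, (pairGraph r S).Adj ⟨x, hxS⟩ p → φ p = κ := by
    by_cases hex : ∃ p, (pairGraph r S).Adj ⟨x, hxS⟩ p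
    · obtain ⟨p, hp⟩ := hex
      exact ⟨φ p, fun q hq => hconst q p hq hp⟩
    · exact ⟨true, fun p hp => (hex ⟨p, hp⟩).elim⟩
  -- `x` gets the colour that continues the alternation, hence differs from all its neighbours in
  -- `pairGraph r S`.
  let g' : α → Bool := Function.update g x (xor κ (decide (col ⟨x, hxS⟩ = 0)))
  have hg' : ∀ z ∈ S.erase x, g' z = g z := fun z hz =>
    Function.update_of_ne (Finset.ne_of_mem_erase hz) _ _
  refine ⟨g', fun b p hp q hq hpq hbp hbq => ?_⟩
  by_cases htwo : ∃ p ∈ S.erase x, ∃ q ∈ S.erase x, p ≠ q ∧ r b p ∧ r b q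
  · obtain ⟨p, hp, q, hq, hpq, hbp, hbq⟩ := htwo
    obtain ⟨p', hp', q', hq', h1, h2, h3⟩ := hg b p hp q hq hpq hbp hbq
    exact ⟨p', Finset.mem_of_mem_erase hp', q', Finset.mem_of_mem_erase hq', h1, h2,
      by rwa [hg' _ hp', hg' _ hq']⟩
  · push Not at htwo
    wlog hpx : p = x generalizing p q
    · by_cases hqx : q = x
      · exact this q hq p hp hpq.symm hbq hbp hqx
      · exact (htwo p (by simp [*]) q (by simp [*]) hpq hbp hbq).elim
    subst hpx
    have hqe : q ∈ S.erase p := Finset.mem_erase.mpr ⟨hpq.symm, hq⟩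
    have hadj : (pairGraph r S).Adj ⟨p, hxS⟩ ⟨q, hq⟩ := by
      refine ⟨fun e => hpq (congrArg Subtype.val e), b, hbp, hbq, fun z hz => ?_⟩
      by_contra! hzz
      refine htwo z (Finset.mem_erase.mpr ⟨fun e => hzz.1 (Subtype.ext e), z.2⟩) q hqe
        (fun e => hzz.2 (Subtype.ext e)) hz hbq
    have h1 := hκ _ hadj
    have h2 : col ⟨p, hxS⟩ ≠ col ⟨q, hq⟩ := col.valid hadj
    have h3 : decide (col ⟨p, hxS⟩ = 0) ≠ decide (col ⟨q, hq⟩ = 0) := by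
      intro e
      rw [decide_eq_decide] at e
      generalize col ⟨p, hxS⟩ = i at *
      generalize col ⟨q, hq⟩ = j at *
      fin_cases i <;> fin_cases j <;> simp_all
    refine ⟨p, hxS, q, hq, hbp, hbq, ?_⟩
    rw [hg' q hqe]
    simp only [g', Function.update_self, ← h1, φ]
    generalize g q = i at *
    generalize decide (col ⟨p, hxS⟩ = 0) = i' at *
    generalize decide (col ⟨q, hq⟩ = 0) = j' at *
    revert h3
    clear * -
    revert i i' j'
    decide

/-- A balanced hypergraph whose edges have at most `d + 1` vertices has a colouring of its
vertices with `d + 1` colours that is injective on every edge. -/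
lemma IsBalanced.exists_strong_coloring [Finite α] [Finite β] (h : IsBalanced r) (d : ℕ)
    (hd : ∀ b, {a | r b a}.ncard ≤ d + 1) :
    ∃ f : α → Fin (d + 1), ∀ b p q, r b p → r b q → f p = f q → p = q := by
  classical
  have := Fintype.ofFinite α
  have := Fintype.ofFinite β
  let R : β → Finset α := fun b => Finset.univ.filter (r b)
  have hR : ∀ {b a}, a ∈ R b ↔ r b a := by simp [R]
  -- Maximise the total number of colours seen by the edges; a repeated colour on `b` leaves some
  -- `κ` missing there, and rebicolouring the classes of `f p` and `κ` improves the sum.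
  obtain ⟨f, hf⟩ := Finite.exists_max fun f : α → Fin (d + 1) => ∑ b, ((R b).image f).card
  refine ⟨f, fun b p q hp hq hpq => ?_⟩
  by_contra hne
  obtain ⟨κ, hκ⟩ : ∃ κ, κ ∉ (R b).image f := by
    by_contra! hall
    have h1 : (R b).card ≤ d + 1 := by
      rw [← Set.ncard_coe_finset]
      simpa [R] using hd b
    have h2 : (R b).card ≤ ((R b).image f).card := by
      rw [Finset.eq_univ_of_forall hall]
      simpa using h1
    have h3 : Set.InjOn f (R b) :=
      Finset.injOn_of_card_image_eq (le_antisymm Finset.card_image_le h2)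
    exact hne (h3 (hR.mpr hp) (hR.mpr hq) hpq)
  let S : Finset α := Finset.univ.filter fun a => f a = f p ∨ f a = κ
  have hS : ∀ {a}, a ∈ S ↔ f a = f p ∨ f a = κ := by simp [S]
  obtain ⟨g, hg⟩ := h.exists_bicoloring S
  let f' : α → Fin (d + 1) := fun a => if a ∈ S then (if g a then f p else κ) else f a
  have hf'S : ∀ a ∈ S, f' a = if g a then f p else κ := fun a ha => by simp [f', ha]
  have hf'n : ∀ a ∉ S, f' a = f a := fun a ha => by simp [f', ha]
  have hboth : ∀ b, ∀ p₁ ∈ S, ∀ q₁ ∈ S, p₁ ≠ q₁ → r b p₁ → r b q₁ →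
      f p ∈ (R b).image f' ∧ κ ∈ (R b).image f' := by
    intro b p₁ hp₁ q₁ hq₁ h1 h2 h3
    obtain ⟨p', hp', q', hq', hbp, hbq, hgne⟩ := hg b p₁ hp₁ q₁ hq₁ h1 h2 h3
    have m1 := Finset.mem_image_of_mem f' (hR.mpr hbp)
    have m2 := Finset.mem_image_of_mem f' (hR.mpr hbq)
    rw [hf'S _ hp'] at m1
    rw [hf'S _ hq'] at m2
    cases hgp : g p' <;> cases hgq : g q' <;> simp_all
  have hsub : ∀ b, f p ∈ (R b).image f' ∧ κ ∈ (R b).image f' →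
      (R b).image f ⊆ (R b).image f' := by
    intro b hb z hz
    obtain ⟨a, ha, rfl⟩ := Finset.mem_image.mp hz
    by_cases haS : a ∈ S
    · rcases hS.mp haS with e | e
      · rw [e]
        exact hb.1
      · rw [e]
        exact hb.2
    · rw [← hf'n a haS]
      exact Finset.mem_image_of_mem _ ha
  have hle : ∀ b, ((R b).image f).card ≤ ((R b).image f').card := by
    intro b
    by_cases htwo : ∃ p₁ ∈ S, ∃ q₁ ∈ S, p₁ ≠ q₁ ∧ r b p₁ ∧ r b q₁
    · obtain ⟨p₁, hp₁, q₁, hq₁, h1, h2, h3⟩ := htwo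
      exact Finset.card_le_card (hsub b (hboth b p₁ hp₁ q₁ hq₁ h1 h2 h3))
    push Not at htwo
    by_cases hone : ∃ z ∈ S, r b z
    · obtain ⟨z, hzS, hz⟩ := hone
      -- The rest of the edge avoids both colours, so recolouring `z` cannot lose a colour.
      have hrest : ∀ a ∈ (R b).erase z, a ∉ S := fun a ha haS =>
        htwo a haS z hzS (Finset.ne_of_mem_erase ha) (hR.mp (Finset.mem_of_mem_erase ha)) hz
      have himg : ((R b).erase z).image f' = ((R b).erase z).image f :=
        Finset.image_congr fun a ha => hf'n a (hrest a ha)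
      have hz' : f' z ∉ ((R b).erase z).image f := by
        intro hm
        obtain ⟨a, ha, e⟩ := Finset.mem_image.mp hm
        refine hrest a ha (hS.mpr ?_)
        rw [e, hf'S z hzS]
        split_ifs
        · exact Or.inl rfl
        · exact Or.inr rfl
      rw [← Finset.insert_erase (hR.mpr hz), Finset.image_insert, Finset.image_insert, himg,
        Finset.card_insert_of_notMem hz']
      exact Finset.card_insert_le _ _
    · push Not at hone
      refine (congrArg Finset.card (Finset.image_congr fun a ha => ?_)).le
      exact (hf'n a fun haS => hone a haS (hR.mp ha)).symm
  refine (hf f').not_gt (Finset.sum_lt_sum (fun b _ => hle b) ⟨b, Finset.mem_univ b, ?_⟩)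
  have hb := hboth b p (hS.mpr (Or.inl rfl)) q (hS.mpr (Or.inl hpq.symm)) hne hp hq
  exact Finset.card_lt_card ⟨hsub b hb, fun hss => hκ (hss hb.2)⟩

/-- König property of balanced hypergraphs: a set `A` of vertices can be covered by as many edges
as there are vertices in some subset of `A` that meets each edge at most once. -/
theorem IsBalanced.exists_stable_cover [Finite α] [Finite β] (h : IsBalanced r) (A : Finset α)
    (hA : ∀ a ∈ A, ∃ b, r b a) :
    ∃ T ⊆ A, ∃ C : Finset β, (∀ b, ∀ p ∈ T, ∀ q ∈ T, r b p → r b q → p = q) ∧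
      (∀ a ∈ A, ∃ b ∈ C, r b a) ∧ C.card ≤ T.card := by
  classical
  have := Fintype.ofFinite α
  have := Fintype.ofFinite β
  induction A using Finset.strongInduction with
  | H A ih =>
  rcases A.eq_empty_or_nonempty with rfl | ⟨a₀, ha₀⟩
  · exact ⟨∅, subset_rfl, ∅, by simp, by simp, by simp⟩
  let B : Finset β := Finset.univ.filter fun b => ∃ a ∈ A, r b a
  have hB : ∀ {b}, b ∈ B ↔ ∃ a ∈ A, r b a := by simp [B]
  have hsmall : ∀ b : B, ∃ T ⊆ A.filter (¬ r b ·), ∃ C : Finset β,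
      (∀ b, ∀ p ∈ T, ∀ q ∈ T, r b p → r b q → p = q) ∧
      (∀ a ∈ A.filter (¬ r b ·), ∃ b ∈ C, r b a) ∧ C.card ≤ T.card := by
    intro b
    obtain ⟨a, ha, hba⟩ := hB.mp b.2
    refine ih _ (Finset.filter_ssubset.mpr ⟨a, ha, by simpa using hba⟩) fun a ha => ?_
    exact hA a (Finset.mem_of_mem_filter a ha)
  choose T hTA C hT hC hCT using hsmall
  obtain ⟨M, hM, hmax⟩ := Finset.exists_max_image
    (A.powerset.filter fun M => ∀ b, ∀ p ∈ M, ∀ q ∈ M, r b p → r b q → p = q) Finset.card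
    ⟨∅, by simp⟩
  simp only [Finset.mem_filter, Finset.mem_powerset] at hM hmax
  -- If deleting the vertices of some edge lowers the stable number, that edge completes the smaller
  -- cover.
  by_cases hsm : ∃ b, (T b).card < M.card
  · obtain ⟨b, hb⟩ := hsm
    refine ⟨M, hM.1, insert b.1 (C b), hM.2, fun a ha => ?_, ?_⟩
    · by_cases hba : r b a
      · exact ⟨b, Finset.mem_insert_self _ _, hba⟩
      · obtain ⟨b', hb', h'⟩ := hC b a (Finset.mem_filter.mpr ⟨ha, hba⟩)
        exact ⟨b', Finset.mem_insert_of_mem hb', h'⟩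
    · exact (Finset.card_insert_le _ _).trans (by have := hCT b; lia)
  push Not at hsm
  exfalso
  have hMpos : 0 < M.card := by
    have := hmax {a₀} ⟨by simpa using ha₀, by simp⟩
    simpa using this
  obtain ⟨b₀, hb₀⟩ := hA a₀ ha₀
  have hb₀B : b₀ ∈ B := hB.mpr ⟨a₀, ha₀, hb₀⟩
  obtain ⟨d, hd⟩ : ∃ d, B.card = d + 2 := by
    obtain ⟨a, ha⟩ := Finset.card_pos.mp (hMpos.trans_le (hsm ⟨b₀, hb₀B⟩))
    have haA := Finset.mem_filter.mp (hTA _ ha)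
    obtain ⟨b, hb⟩ := hA a haA.1
    have : 1 < B.card := Finset.one_lt_card.mpr
      ⟨b₀, hb₀B, b, hB.mpr ⟨a, haA.1, hb⟩, fun e => haA.2 (e ▸ hb)⟩
    exact ⟨B.card - 2, by lia⟩
  -- Take the disjoint union of all `T b`. An edge of `B` misses its own `T b` and meets each other
  -- one at most once, so it has at most `B.card - 1 = d + 1` points. Some class among `d + 1`
  -- colours then exceeds `M.card` and is stable, against maximality.
  let s : β → (Σ b : B, T b) → Prop := fun b j => r b j.2
  have hs : IsBalanced s := fun k hodd hk x y hxy => h k hodd hk (fun i => (x i).2) y hxy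
  obtain ⟨f, hf⟩ := hs.exists_strong_coloring d (by
    intro b
    by_cases hbB : b ∈ B
    · have hmaps : ∀ j ∈ {j | s b j}, j.1.1 ∈ (B.erase b : Set β) := by
        intro j hj
        simp only [Finset.coe_erase, Set.mem_sdiff, Finset.mem_coe, Set.mem_singleton_iff]
        refine ⟨j.1.2, fun e => ?_⟩
        have := (Finset.mem_filter.mp (hTA _ j.2.2)).2
        rw [e] at this
        exact this hj
      have hinj : Set.InjOn (fun j : Σ b : B, T b => j.1.1) {j | s b j} := by
        rintro ⟨b₁, a₁⟩ h₁ ⟨b₂, a₂⟩ h₂ e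
        obtain rfl : b₁ = b₂ := Subtype.ext e
        obtain rfl : a₁ = a₂ := Subtype.ext (hT b₁ b _ a₁.2 _ a₂.2 h₁ h₂)
        rfl
      have := Set.ncard_le_ncard_of_injOn _ hmaps hinj (Finset.finite_toSet _)
      rw [Set.ncard_coe_finset, Finset.card_erase_of_mem hbB, hd] at this
      exact this
    · have : {j | s b j} = ∅ := by
        ext j
        simp only [Set.mem_ofPred_eq, Set.mem_empty_iff_false, iff_false]
        exact fun hj => hbB (hB.mpr ⟨_, (Finset.mem_filter.mp (hTA _ j.2.2)).1, hj⟩)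
      simp [this])
  have hcard : (d + 1) * M.card < Fintype.card (Σ b : B, T b) := by
    rw [Fintype.card_sigma]
    calc (d + 1) * M.card < (d + 2) * M.card := Nat.mul_lt_mul_of_pos_right (by lia) hMpos
      _ = ∑ _b : B, M.card := by simp [hd]
      _ ≤ ∑ b : B, Fintype.card (T b) := Finset.sum_le_sum fun b _ => by simpa using hsm b
  obtain ⟨κ, hκ⟩ := Fintype.exists_lt_card_fiber_of_mul_lt_card (f := f) (n := M.card)
    (by simpa using hcard)
  have hinj : Set.InjOn (fun j : Σ b : B, T b => j.2.1)
      (Finset.univ.filter fun j => f j = κ : Finset _) := by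
    intro j hj j' hj' e
    simp only [Finset.coe_filter, Finset.mem_univ, true_and, Set.mem_ofPred_eq] at hj hj'
    obtain ⟨b, hb⟩ := hA _ (Finset.mem_filter.mp (hTA _ j.2.2)).1
    refine hf b j j' hb ?_ (hj.trans hj'.symm)
    dsimp only at e
    change r b j'.2.1
    rwa [← e]
  have := hmax ((Finset.univ.filter fun j => f j = κ).image fun j => j.2.1) ⟨?_, ?_⟩
  · rw [Finset.card_image_of_injOn hinj] at this
    exact this.not_gt hκ
  · intro a ha
    obtain ⟨j, -, rfl⟩ := Finset.mem_image.mp ha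
    exact (Finset.mem_filter.mp (hTA _ j.2.2)).1
  · intro b p hp q hq hbp hbq
    obtain ⟨j, hj, rfl⟩ := Finset.mem_image.mp hp
    obtain ⟨j', hj', rfl⟩ := Finset.mem_image.mp hq
    rw [hf b j j' hbp hbq ((Finset.mem_filter.mp hj).2.trans (Finset.mem_filter.mp hj').2.symm)]

end Balanced

/-! ### Stars as closed neighbourhoods, and odd suns -/

section Stars

variable {V : Type*} {G : SimpleGraph V}

lemma IsStar.exists_center {S : G.Subgraph} (hS : IsStar S) : ∃ c, ∀ w ∈ S.verts, Near G c w := by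
  obtain ⟨-, c, -, hc⟩ := hS
  refine ⟨c, fun w hw => ?_⟩
  by_cases h : w = c
  · exact Or.inl h.symm
  · exact Or.inr (hc w hw h).adj_sub

/-- The star spanning the closed neighbourhood of `c`. -/
def fullStar (G : SimpleGraph V) (c : V) : G.Subgraph where
  verts := {w | Near G c w}
  Adj u w := G.Adj u w ∧ (u = c ∨ w = c)
  adj_sub h := h.1
  edge_vert := by
    rintro u w ⟨h, rfl | rfl⟩
    · exact Near.refl _
    · exact Or.inr h.symm
  symm := ⟨fun _ _ h => ⟨h.1.symm, h.2.symm⟩⟩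

lemma isStar_fullStar (c : V) : IsStar (fullStar G c) := by
  refine ⟨?_, c, Near.refl c, fun w hw hwc => ⟨hw.resolve_left (Ne.symm hwc), Or.inl rfl⟩⟩
  have : (fullStar G c).coe = starGraph ⟨c, Near.refl c⟩ := by
    ext ⟨u, hu⟩ ⟨w, hw⟩
    simp only [Subgraph.coe_adj, starGraph_adj, ne_eq, Subtype.ext_iff]
    constructor
    · rintro ⟨h, h'⟩
      exact ⟨h.ne, h'⟩
    · rintro ⟨hne, rfl | rfl⟩
      · exact ⟨hw.resolve_left hne, Or.inl rfl⟩
      · exact ⟨(hu.resolve_left (Ne.symm hne)).symm, Or.inr rfl⟩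
  rw [this]
  exact isTree_starGraph _

lemma isSIndependent_iff {T : Finset V} :
    IsSIndependent G T ↔ ∀ c, ∀ p ∈ T, ∀ q ∈ T, Near G c p → Near G c q → p = q := by
  constructor
  · intro h c p hp q hq hcp hcq
    by_contra hne
    exact h p hp q hq hne ⟨fullStar G c, isStar_fullStar c, hcp, hcq⟩
  · rintro h p hp q hq hne ⟨S, hS, hpS, hqS⟩
    obtain ⟨c, hc⟩ := hS.exists_center
    exact hne (h c p hp q hq (hc p hpS) (hc q hqS))

lemma IsStarCover.exists_dominating {F : Finset G.Subgraph} (hF : IsStarCover G F) :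
    ∃ C : Finset V, C.card ≤ F.card ∧ ∀ v, ∃ c ∈ C, Near G c v := by
  classical
  choose c hc using fun S : F => (hF.1 S S.2).exists_center
  refine ⟨Finset.univ.image c, Finset.card_image_le.trans (by simp), fun v => ?_⟩
  obtain ⟨S, hS, hv⟩ := hF.2 v
  exact ⟨c ⟨S, hS⟩, Finset.mem_image_of_mem c (Finset.mem_univ _), hc ⟨S, hS⟩ v hv⟩

lemma exists_isStarCover {C : Finset V} (hC : ∀ v, ∃ c ∈ C, Near G c v) :
    ∃ F : Finset G.Subgraph, IsStarCover G F ∧ F.card ≤ C.card := by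
  classical
  refine ⟨C.image (fullStar G), ⟨fun S hS => ?_, fun v => ?_⟩, Finset.card_image_le⟩
  · obtain ⟨c, -, rfl⟩ := Finset.mem_image.mp hS
    exact isStar_fullStar c
  · obtain ⟨c, hc, hv⟩ := hC v
    exact ⟨_, Finset.mem_image_of_mem _ hc, hv⟩

lemma IsSIndependent.card_le {T : Finset V} (hT : IsSIndependent G T) {F : Finset G.Subgraph}
    (hF : IsStarCover G F) : T.card ≤ F.card := by
  choose S hS hv using hF.2
  refine Finset.card_le_card_of_injOn S (fun v _ => hS v) fun p hp q hq e => ?_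
  by_contra hne
  exact hT p hp q hq hne ⟨S p, hF.1 _ (hS p), hv p, e ▸ hv q⟩

lemma near_induce {D : Set V} {u v : D} : Near (G.induce D) u v ↔ Near G u v := by
  simp [Near, Subtype.ext_iff]

lemma IsBalanced.induce (h : IsBalanced (Near G)) (D : Set V) :
    IsBalanced (Near (G.induce D)) := fun k hodd hk x y hxy =>
  h k hodd hk (fun i => x i) (fun i => y i) fun i j => near_induce.symm.trans (hxy i j)

variable [Finite V]

lemma exists_starCoverNumber (G : SimpleGraph V) :
    ∃ F : Finset G.Subgraph, IsStarCover G F ∧ F.card = starCoverNumber G := by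
  have := Fintype.ofFinite V
  refine Nat.sInf_mem (s := {n | ∃ F : Finset G.Subgraph, IsStarCover G F ∧ F.card = n}) ?_
  obtain ⟨F, hF, -⟩ := exists_isStarCover (G := G) (C := Finset.univ)
    fun v => ⟨v, Finset.mem_univ v, Near.refl v⟩
  exact ⟨_, F, hF, rfl⟩

lemma bddAbove_sIndependent (G : SimpleGraph V) :
    BddAbove {n : ℕ | ∃ T : Finset V, IsSIndependent G T ∧ T.card = n} := by
  have := Fintype.ofFinite V
  refine ⟨Fintype.card V, ?_⟩
  rintro _ ⟨T, -, rfl⟩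
  exact T.card_le_univ

lemma exists_sIndependenceNumber (G : SimpleGraph V) :
    ∃ T : Finset V, IsSIndependent G T ∧ T.card = sIndependenceNumber G :=
  Nat.sSup_mem (s := {n | ∃ T : Finset V, IsSIndependent G T ∧ T.card = n})
    ⟨0, ∅, by simp [IsSIndependent], rfl⟩ (bddAbove_sIndependent G)

/-- Weak duality gives one inequality, so a cover no larger than an independent set certifies
equality. -/
lemma starCoverNumber_eq_of_le {T C : Finset V} (hT : IsSIndependent G T)
    (hC : ∀ v, ∃ c ∈ C, Near G c v) (hCT : C.card ≤ T.card) :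
    starCoverNumber G = sIndependenceNumber G := by
  apply le_antisymm
  · obtain ⟨F, hF, hFC⟩ := exists_isStarCover hC
    have h₁ : starCoverNumber G ≤ F.card := Nat.sInf_le ⟨F, hF, rfl⟩
    have h₂ : T.card ≤ sIndependenceNumber G := le_csSup (bddAbove_sIndependent G) ⟨T, hT, rfl⟩
    exact h₁.trans ((hFC.trans hCT).trans h₂)
  · obtain ⟨F, hF, hF'⟩ := exists_starCoverNumber G
    obtain ⟨T, hT, hT'⟩ := exists_sIndependenceNumber G
    exact hF' ▸ hT' ▸ hT.card_le hF

lemma IsBalanced.starCoverNumber_eq (h : IsBalanced (Near G)) :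
    starCoverNumber G = sIndependenceNumber G := by
  have := Fintype.ofFinite V
  obtain ⟨T, -, C, hT, hC, hCT⟩ := h.exists_stable_cover Finset.univ
    fun v _ => ⟨v, Near.refl v⟩
  exact starCoverNumber_eq_of_le (isSIndependent_iff.mpr hT)
    (fun v => hC v (Finset.mem_univ v)) hCT

/-- Odd suns have different star-covering and `S`-independence numbers. -/
lemma IsSun.starCoverNumber_ne {k : ℕ} (hodd : Odd k) (h : IsSun k G) :
    starCoverNumber G ≠ sIndependenceNumber G := by
  classical
  intro heq
  obtain ⟨hk, v, u, hv, hu, hvu, hcov, hvv, huw⟩ := h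
  have : NeZero k := ⟨by lia⟩
  have h1 := zmod_one_ne_zero hk
  obtain ⟨F, hF, hF'⟩ := exists_starCoverNumber G
  obtain ⟨T, hT, hT'⟩ := exists_sIndependenceNumber G
  obtain ⟨C, hCF, hC⟩ := hF.exists_dominating
  rw [isSIndependent_iff] at hT
  -- Each vertex is near two consecutive `v i`, and these pairs are disjoint for distinct members of
  -- `T`.
  have hTk : T.card * 2 ≤ k := by
    have htwo : ∀ t : V, ∃ i, Near G (v i) t ∧ Near G (v (i + 1)) t := fun t => by
      obtain ⟨i, rfl⟩ | ⟨i, rfl⟩ := hcov t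
      · exact ⟨i, Near.refl _, Or.inr (hvv i).symm⟩
      · exact ⟨i, Or.inr ((huw i _).mpr (Or.inl rfl)).symm,
          Or.inr ((huw i _).mpr (Or.inr rfl)).symm⟩
    choose i h₁ h₂ using htwo
    have hdisj : (T : Set V).PairwiseDisjoint fun t => ({i t, i t + 1} : Finset (ZMod k)) := by
      intro p hp q hq hne
      rw [Function.onFun, Finset.disjoint_left]
      intro j hjp hjq
      have near : ∀ t, j ∈ ({i t, i t + 1} : Finset (ZMod k)) → Near G (v j) t := fun t ht => by
        rcases Finset.mem_insert.mp ht with rfl | ht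
        · exact h₁ t
        · rw [Finset.mem_singleton.mp ht]
          exact h₂ t
      exact hne (hT _ p hp q hq (near p hjp) (near q hjq))
    have hcard := (T.biUnion fun t => ({i t, i t + 1} : Finset (ZMod k))).card_le_univ
    rw [Finset.card_biUnion hdisj, ZMod.card] at hcard
    refine le_trans (le_of_eq ?_) hcard
    rw [Finset.sum_congr rfl fun t _ => Finset.card_pair (by simpa using h1), Finset.sum_const,
      smul_eq_mul]
  -- Each vertex dominates at most two of the `u j`.
  have hCk : k ≤ C.card * 2 := by
    have htwo : ∀ c : V, ∃ i, ∀ j, Near G c (u j) → j = i ∨ j = i - 1 := fun c => by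
      obtain ⟨i, rfl⟩ | ⟨i, rfl⟩ := hcov c
      · refine ⟨i, fun j hj => ?_⟩
        have hj := (huw j _).mp (hj.resolve_left (hvu i j)).symm
        refine hj.imp (fun e => (hv e).symm) fun e => ?_
        rw [hv e]
        ring
      · refine ⟨i, fun j hj => Or.inl ?_⟩
        rcases hj with e | e
        · exact (hu e).symm
        · rcases (huw i _).mp e with e | e
          · exact (hvu _ _ e.symm).elim
          · exact (hvu _ _ e.symm).elim
    choose i hi using htwo
    have hsub : (Finset.univ : Finset (ZMod k)) ⊆ C.biUnion fun c => {i c, i c - 1} := by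
      intro j _
      obtain ⟨c, hc, hcj⟩ := hC (u j)
      exact Finset.mem_biUnion.mpr ⟨c, hc, by simpa using hi c j hcj⟩
    have hcard := (Finset.card_le_card hsub).trans
      (Finset.card_biUnion_le_card_mul _ _ 2 fun c _ => Finset.card_le_two)
    rwa [Finset.card_univ, ZMod.card] at hcard
  obtain ⟨m, rfl⟩ := hodd
  lia

end Stars

end SPerfect

theorem theorem2p13 {V : Type*} [Finite V] (G : SimpleGraph V)
    (hG : SPerfect.IsTriangulated G) :
    SPerfect.IsSPerfect G ↔ SPerfect.IsOddSunFree G := by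
  constructor
  · rintro h D ⟨k, hodd, hsun⟩
    exact hsun.starCoverNumber_ne hodd (h D)
  · exact fun h D => ((h.isBalanced hG).induce D).starCoverNumber_eq
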